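/- A lattice $\mathcal L\subset\mathbb R^d$ of rank $n$ is the set of all integer combinations of $n$ linearly independent vectors $\mathbf B=(b_1,\dots,b_n)$ (a basis of $\mathcal L$); $\det(\mathcal L)=\det(\mathbf B^T\mathbf B)^{1/2}$; $\lambda_1(\mathcal L)$ is the length of a shortest non-zero vector of $\mathcal L$; and Hermite's constant is $\delta_n=\sup_{\mathrm{rank}(\mathcal L)=n}\bigl(\lambda_1(\mathcal L)/\det(\mathcal L)^{1/n}\bigr)^2$. The dual lattice is $\mathcal L^*=\{w\in\mathrm{span}(\mathcal L):\langle w,y\rangle\in\mathbb Z\text{ for all }y\in\mathcal L\}$. A solution of $\gamma$-HSVP on a rank-$n$ lattice $\mathcal L$ is a vector $y\in\mathcal L\setminus\{0\}$ with $\|y\|\le\gamma\det(\mathcal L)^{1/n}$. Let $k\ge2$, and suppose that we have an oracle which, given any basis of any rank-$k$ lattice in $\mathbb R^d$, returns a solution of $\sqrt{\delta_k}$-HSVP on it. Consider the following recursive reduction $\mathcal A(\mathcal L,\tau)$, for a lattice $\mathcal L\subset\mathbb R^d$ and a depth parameter $\tau\in\mathbb N$: 1. Base cases: (a) if $\tau=0$,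 run LLL on $\mathcal L$ and output the first vector of the resulting LLL-reduced basis (with parameter $3/4$); (b) otherwise, if $\mathrm{rank}(\mathcal L)=k$, call the oracle on (a basis of) $\mathcal L$ and output its answer. 2. Otherwise, compute $w\leftarrow\mathcal A(\mathcal L^*,\tau-1)$ and output $y\leftarrow\mathcal A(\mathcal L\cap w^\perp,\tau)$. The result does not depend on how lattices are represented: LLL may return any LLL-reduced basis of its input lattice, and the oracle may be called on any basis of its input lattice. Then for all $n\ge k$ and $\tau\ge0$, and for every rank-$n$ lattice $\mathcal L$, the reduction has a run on $(\mathcal L,\tau)$, and every run satisfies the following. (i) The output is a solution of $\gamma$-HSVP on $\mathcal L$ with $$\gamma=\delta_k^{\frac{n-1}{2(k-1)}}\cdot 2^{n^3/2^\tau}.$$ In particular, if $\tau\ge3\log_2 n$, it is a solution of $\gamma$-HSVP with $\gamma=2\,\delta_k^{\frac{n-1}{2(k-1)}}$, i.e., the reduction matches the basis-reduction tradeoff $\delta_k^{(n-1)/(2(k-1))}$ up to a factor of at most $2$. (ii) If $\tau\ge1$, the run makes exactly $\binom{n-k+\tau-1}{\tau-1}$ oracle calls; if $\tau=0$, it makes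 none. Moreover, the complexity for $\tau=\lceil3\log_2 n\rceil$ is quasipolynomial, where complexity is measured by the number of oracle calls and by the total number of operations, an operation being an oracle call, a run of LLL, the computation of a dual lattice, or the computation of an intersection $\mathcal L\cap w^\perp$. That is, there are absolute constants $C,c_0>0$ such that, for all $n\ge k\ge2$, every rank-$n$ lattice $\mathcal L$ and every run on $(\mathcal L,\lceil3\log_2 n\rceil)$, both the number of oracle calls and the total number of operations are at most $n^{C\log_2 n}$; and the number of oracle calls is at least $n^{c_0\log_2 n}$ whenever $k\le n/2$. -/

import Mathlib

noncomputable section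

/-- The ambient Euclidean space `ℝ^d`. -/
abbrev Vec (d : ℕ) : Type := EuclideanSpace ℝ (Fin d)

/-- The lattice of all integer linear combinations of the columns of `B`. -/
def latticeOf {n d : ℕ} (B : Fin n → Vec d) : Submodule ℤ (Vec d) :=
  Submodule.span ℤ (Set.range B)

/-- `B` is a basis of the lattice `L`: linearly independent vectors that generate `L`. -/
def IsLatticeBasis {n d : ℕ} (B : Fin n → Vec d) (L : Submodule ℤ (Vec d)) : Prop :=
  LinearIndependent ℝ B ∧ latticeOf B = L

/-- `L` is a lattice of rank `n`. -/
def HasRank {d : ℕ} (L : Submodule ℤ (Vec d)) (n : ℕ) : Prop :=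
  ∃ B : Fin n → Vec d, IsLatticeBasis B L

/-- The determinant `det(Bᵀ B)^(1/2)` of the lattice with basis `B`. -/
def basisDet {n d : ℕ} (B : Fin n → Vec d) : ℝ :=
  Real.sqrt (Matrix.gram ℝ B).det

/-- The length of a shortest non-zero vector of `L`. -/
def minLength {d : ℕ} (L : Submodule ℤ (Vec d)) : ℝ :=
  sInf {r : ℝ | ∃ y ∈ L, y ≠ 0 ∧ r = ‖y‖}

/-- Hermite's constant `δ_n`, the supremum of `(λ₁(L) / det(L)^(1/n))²` over all lattices of
rank `n`. -/
def hermiteConst (n : ℕ) : ℝ :=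
  sSup {r : ℝ | ∃ (d : ℕ) (B : Fin n → Vec d), LinearIndependent ℝ B ∧
    r = (minLength (latticeOf B) / basisDet B ^ (1 / (n : ℝ))) ^ 2}

/-- `y` solves `γ`-HSVP on the lattice with basis `B`. -/
def IsHSVPSolution {n d : ℕ} (γ : ℝ) (B : Fin n → Vec d) (y : Vec d) : Prop :=
  y ∈ latticeOf B ∧ y ≠ 0 ∧ ‖y‖ ≤ γ * basisDet B ^ (1 / (n : ℝ))

/-- `O` is an oracle for `γ`-HSVP on lattices of rank `k`. -/
def IsHSVPOracle {k d : ℕ} (γ : ℝ) (O : (Fin k → Vec d) → Vec d) : Prop :=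
  ∀ B : Fin k → Vec d, LinearIndependent ℝ B → IsHSVPSolution γ B (O B)

/-- The dual lattice `L* = {w ∈ span L : ⟪w, y⟫ ∈ ℤ for all y ∈ L}`. -/
def dualLattice {d : ℕ} (L : Submodule ℤ (Vec d)) : Submodule ℤ (Vec d) where
  carrier := {w | w ∈ Submodule.span ℝ (L : Set (Vec d)) ∧
    ∀ y ∈ L, ∃ m : ℤ, inner ℝ w y = (m : ℝ)}
  zero_mem' := ⟨Submodule.zero_mem _, fun y _ => ⟨0, by simp⟩⟩
  add_mem' := by
    rintro a b ⟨ha, ha'⟩ ⟨hb, hb'⟩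
    refine ⟨Submodule.add_mem _ ha hb, fun y hy => ?_⟩
    obtain ⟨m, hm⟩ := ha' y hy
    obtain ⟨m', hm'⟩ := hb' y hy
    exact ⟨m + m', by rw [inner_add_left, hm, hm']; push_cast; rfl⟩
  smul_mem' := by
    rintro c a ⟨ha, ha'⟩
    refine ⟨(Submodule.span ℝ (L : Set (Vec d))).toAddSubgroup.zsmul_mem ha c, fun y hy => ?_⟩
    obtain ⟨m, hm⟩ := ha' y hy
    refine ⟨c * m, ?_⟩
    rw [← Int.cast_smul_eq_zsmul ℝ c a, real_inner_smul_left, hm]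
    push_cast
    rfl

/-- The intersection `L ∩ w^⊥`. -/
def orthSection {d : ℕ} (L : Submodule ℤ (Vec d)) (w : Vec d) : Submodule ℤ (Vec d) :=
  L ⊓ (Submodule.span ℝ {w})ᗮ.restrictScalars ℤ

/-- The Gram-Schmidt coefficient `μ_{i,j} = ⟪b*_i, b_j⟫ / ‖b*_i‖²`. -/
def gsCoeff {n d : ℕ} (B : Fin n → Vec d) (i j : Fin n) : ℝ :=
  inner ℝ (InnerProductSpace.gramSchmidt ℝ B i) (B j) /
    ‖InnerProductSpace.gramSchmidt ℝ B i‖ ^ 2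

/-- LLL-reduced bases, with the usual parameter `3/4`: the basis is size-reduced and satisfies
the Lovász condition at each pair of consecutive vectors. -/
def IsLLLReduced {n d : ℕ} (B : Fin n → Vec d) : Prop :=
  LinearIndependent ℝ B ∧
  (∀ i j : Fin n, i ≠ j → |gsCoeff B i j| ≤ 1 / 2) ∧
  ∀ i j : Fin n, (j : ℕ) = (i : ℕ) + 1 →
    3 / 4 * ‖InnerProductSpace.gramSchmidt ℝ B i‖ ^ 2 ≤
      ‖InnerProductSpace.gramSchmidt ℝ B j‖ ^ 2 +
        gsCoeff B i j ^ 2 * ‖InnerProductSpace.gramSchmidt ℝ B i‖ ^ 2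

/-- The recursive reduction `A(L, τ)` with rank-`k` oracle `O`.
`Run O L τ y c t` says that a run of the reduction on input `(L, τ)` outputs the vector `y`, makes
exactly `c` oracle calls, and performs exactly `t` operations in total, where an operation is a run
of LLL, an oracle call, the computation of a dual lattice, or the computation of an intersection
`L ∩ w^⊥`. Lattices are independent of their representation: LLL may return any LLL-reduced basis
of `L`, and the oracle may be called on any basis of `L`. -/
inductive Run {k d : ℕ} (O : (Fin k → Vec d) → Vec d) :
    Submodule ℤ (Vec d) → ℕ → Vec d → ℕ → ℕ → Prop
  /-- If `τ = 0`, run LLL and output the first vector of the resulting basis. -/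
  | lll {L : Submodule ℤ (Vec d)} {m : ℕ} (B : Fin m → Vec d) (hB : IsLatticeBasis B L)
      (hred : IsLLLReduced B) (hm : 0 < m) :
      Run O L 0 (B ⟨0, hm⟩) 0 1
  /-- If `rank L = k`, call the oracle on `L`. -/
  | oracle {L : Submodule ℤ (Vec d)} {τ : ℕ} (B : Fin k → Vec d) (hB : IsLatticeBasis B L) :
      Run O L (τ + 1) (O B) 1 1
  /-- Otherwise compute `w ← A(L*, τ - 1)` and output `y ← A(L ∩ w^⊥, τ)`. -/
  | step {L : Submodule ℤ (Vec d)} {τ : ℕ} {w y : Vec d} {c₁ c₂ t₁ t₂ : ℕ}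
      (hk : ¬ HasRank L k)
      (hw : Run O (dualLattice L) τ w c₁ t₁)
      (hy : Run O (orthSection L w) (τ + 1) y c₂ t₂) :
      Run O L (τ + 1) y (c₁ + c₂) (t₁ + t₂ + 2)

end

/-! Let L have rank n + 1. If w is a nonzero vector of L*, then L ∩ w^⊥ has rank n and determinant
at most ‖w‖ det L. Suppose w solves γ₁-HSVP on L*, where det L* = 1 / det L, and y solves γ₂-HSVP on
the section. Substituting the first bound in the second shows that y solves γ₂ γ₁^(1/n)-HSVP on L
(`IsHSVPSolution.of_section`).

The exponent (n - 1) / (2(k - 1)) of δ_k satisfies this recursion with equality, so all loss sits in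
a power of 2. That loss starts at the LLL factor 2^((n-1)/4), and each dual call passes it on
divided by the rank. The cubic n(n - 1)(n - 2) / 2^τ dominates the accumulated loss
(`slackExponent_step`).

The run lengths depend only on m = n - k and τ, and obey Pascal's rule. Quasipolynomiality thus
reduces to two-sided bounds on binomial coefficients with lower index about 3 log₂ n.

Runs exist because each intermediate object is again a lattice of the expected rank and every
lattice has an LLL-reduced basis (`exists_lllReduced_basis`). All of this is joined in `run_spec`,
by induction on τ and then on m. -/

/-! ### Bases, rank and determinant of a lattice. -/

theorem mem_latticeOf_iff {n d : ℕ} {B : Fin n → Vec d} {x : Vec d} :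
    x ∈ latticeOf B ↔ ∃ a : Fin n → ℤ, ∑ i, a i • B i = x :=
  Submodule.mem_span_range_iff_exists_fun ℤ

theorem mem_latticeOf {n d : ℕ} (B : Fin n → Vec d) (i : Fin n) : B i ∈ latticeOf B :=
  Submodule.subset_span ⟨i, rfl⟩

theorem span_latticeOf {n d : ℕ} (B : Fin n → Vec d) :
    Submodule.span ℝ (latticeOf B : Set (Vec d)) = Submodule.span ℝ (Set.range B) :=
  Submodule.span_span_of_tower ℤ ℝ _

theorem finrank_span_latticeOf {n d : ℕ} {B : Fin n → Vec d} (hB : LinearIndependent ℝ B) :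
    Module.finrank ℝ (Submodule.span ℝ (latticeOf B : Set (Vec d))) = n := by
  rw [span_latticeOf, finrank_span_eq_card hB, Fintype.card_fin]

theorem IsLatticeBasis.rank_eq {n m d : ℕ} {B : Fin n → Vec d} {B' : Fin m → Vec d}
    {L : Submodule ℤ (Vec d)} (hB : IsLatticeBasis B L) (hB' : IsLatticeBasis B' L) : n = m := by
  rw [← finrank_span_latticeOf hB.1, ← finrank_span_latticeOf hB'.1, hB.2, hB'.2]

/-- A generating family of a rank-`n` lattice that has `n` members is linearly independent. -/
theorem linearIndependent_of_latticeOf_eq {n d : ℕ} {B B' : Fin n → Vec d}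
    (hB : LinearIndependent ℝ B) (h : latticeOf B' = latticeOf B) : LinearIndependent ℝ B' := by
  rw [linearIndependent_iff_card_eq_finrank_span, Set.finrank, ← span_latticeOf, h,
    finrank_span_latticeOf hB, Fintype.card_fin]

theorem LinearIndependent.int_of_real {n d : ℕ} {B : Fin n → Vec d}
    (hB : LinearIndependent ℝ B) : LinearIndependent ℤ B :=
  hB.restrict_scalars' ℤ

/-- The number of members of a `ℤ`-linearly independent generating family is the rank. -/
theorem card_eq_of_linearIndependent_int {n m d : ℕ} {B : Fin n → Vec d} {B' : Fin m → Vec d}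
    (hB : LinearIndependent ℝ B) (hB' : LinearIndependent ℤ B')
    (h : latticeOf B' = latticeOf B) : m = n := by
  have h1 := finrank_span_eq_card hB.int_of_real
  have h2 := finrank_span_eq_card hB'
  rw [Fintype.card_fin] at h1 h2
  rw [← h1, ← h2]
  exact congrArg (fun S : Submodule ℤ (Vec d) => Module.finrank ℤ S) h

theorem gram_linearCombination {n m d : ℕ} {B : Fin n → Vec d} {B' : Fin m → Vec d}
    {U : Matrix (Fin m) (Fin n) ℝ} (h : ∀ i, B' i = ∑ j, U i j • B j) :
    Matrix.gram ℝ B' = U * Matrix.gram ℝ B * U.transpose := by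
  ext i j
  simp only [Matrix.gram_apply, h, sum_inner, inner_sum, Matrix.mul_apply, real_inner_smul_left,
    real_inner_smul_right, Matrix.transpose_apply, Finset.sum_mul]
  exact Finset.sum_congr rfl fun x _ => Finset.sum_congr rfl fun y _ => by ring

theorem det_gram_pos {n d : ℕ} {B : Fin n → Vec d} (hB : LinearIndependent ℝ B) :
    0 < (Matrix.gram ℝ B).det :=
  (Matrix.posDef_gram_of_linearIndependent hB).det_pos

theorem basisDet_pos {n d : ℕ} {B : Fin n → Vec d} (hB : LinearIndependent ℝ B) :
    0 < basisDet B :=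
  Real.sqrt_pos.2 (det_gram_pos hB)

/-- The determinant of a lattice does not depend on the basis. -/
theorem IsLatticeBasis.basisDet_eq {n d : ℕ} {B B' : Fin n → Vec d} {L : Submodule ℤ (Vec d)}
    (hB : IsLatticeBasis B L) (hB' : IsLatticeBasis B' L) : basisDet B = basisDet B' := by
  have key : ∀ {B B' : Fin n → Vec d}, latticeOf B = latticeOf B' →
      ∃ U : Matrix (Fin n) (Fin n) ℤ, ∀ i, B i = ∑ j, (U i j : ℝ) • B' j := by
    intro B B' h
    choose U hU using fun i => mem_latticeOf_iff.1 (h ▸ mem_latticeOf B i)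
    exact ⟨U, fun i => by simp [← hU i, Int.cast_smul_eq_zsmul]⟩
  obtain ⟨U, hU⟩ := key (hB.2.trans hB'.2.symm)
  obtain ⟨V, hV⟩ := key (hB'.2.trans hB.2.symm)
  have hUg := congrArg Matrix.det
    (gram_linearCombination (U := U.map (Int.cast : ℤ → ℝ)) (by simpa using hU))
  have hVg := congrArg Matrix.det
    (gram_linearCombination (U := V.map (Int.cast : ℤ → ℝ)) (by simpa using hV))
  have hdet : ∀ W : Matrix (Fin n) (Fin n) ℤ,
      (W.map (Int.cast : ℤ → ℝ)).det = ((W.det : ℤ) : ℝ) := fun W =>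
    ((Int.castRingHom ℝ).map_det W).symm
  simp only [Matrix.det_mul, Matrix.det_transpose, hdet] at hUg hVg
  have hpos := det_gram_pos hB'.1
  -- Comparing Gram determinants in both directions makes det U² an integer unit, without showing
  -- that U and V are inverse.
  have hsq : U.det ^ 2 * V.det ^ 2 = 1 := by
    rw [hVg] at hUg
    have h3 := det_gram_pos hB.1
    have : ((U.det : ℝ) ^ 2 * (V.det : ℝ) ^ 2) * (Matrix.gram ℝ B).det
        = 1 * (Matrix.gram ℝ B).det := by
      linear_combination -hUg
    exact_mod_cast mul_right_cancel₀ h3.ne' this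
  have hU1 : U.det ^ 2 = 1 :=
    Int.eq_one_of_mul_eq_one_right (sq_nonneg _) hsq
  have hU2 : (U.det : ℝ) ^ 2 = 1 := by exact_mod_cast hU1
  rw [basisDet, basisDet, hUg]
  congr 1
  linear_combination (Matrix.gram ℝ B').det * hU2

/-! ### Dual lattices and orthogonal sections. -/

theorem mem_orthSection_iff {d : ℕ} {L : Submodule ℤ (Vec d)} {w y : Vec d} :
    y ∈ orthSection L w ↔ y ∈ L ∧ inner ℝ w y = 0 := by
  simp [orthSection, Submodule.mem_orthogonal_singleton_iff_inner_right]

/-- The dual lattice has the same rank, and the determinants are inverse to each other. -/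
theorem exists_dual_basis {n d : ℕ} {B : Fin n → Vec d} (hB : LinearIndependent ℝ B) :
    ∃ D : Fin n → Vec d, IsLatticeBasis D (dualLattice (latticeOf B)) ∧
      basisDet D = (basisDet B)⁻¹ := by
  set G := Matrix.gram ℝ B with hG
  have hGu : IsUnit G.det := (det_gram_pos hB).ne'.isUnit
  -- The dual basis has coordinates G⁻¹ in terms of `B`, so its Gram matrix is G⁻¹ G G⁻ᵀ = G⁻¹.
  set D : Fin n → Vec d := fun i => ∑ j, G⁻¹ i j • B j with hD
  have hDB : ∀ i j, inner ℝ (D i) (B j) = if i = j then (1 : ℝ) else 0 := by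
    intro i j
    have := congrFun (congrFun (Matrix.nonsing_inv_mul G hGu) i) j
    rw [Matrix.mul_apply, Matrix.one_apply] at this
    simpa [hD, hG, sum_inner, real_inner_smul_left] using this
  have hGD : Matrix.gram ℝ D = G⁻¹ := by
    rw [gram_linearCombination (U := G⁻¹) (fun i => rfl), ← hG, Matrix.nonsing_inv_mul G hGu,
      one_mul, Matrix.transpose_nonsing_inv]
    congr 1
    ext i j
    simp [hG, real_inner_comm]
  have hdet : (Matrix.gram ℝ D).det = G.det⁻¹ := by
    rw [hGD, Matrix.det_nonsing_inv, Ring.inverse_eq_inv']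
  have hDli : LinearIndependent ℝ D :=
    Matrix.det_gram_ne_zero_iff_linearIndependent (𝕜 := ℝ).1
      (hdet ▸ inv_ne_zero (det_gram_pos hB).ne')
  refine ⟨D, ⟨hDli, le_antisymm ?_ ?_⟩, by rw [basisDet, hdet, Real.sqrt_inv]; rfl⟩
  · refine Submodule.span_le.2 ?_
    rintro _ ⟨i, rfl⟩
    refine ⟨?_, fun y hy => ?_⟩
    · rw [span_latticeOf]
      exact Submodule.sum_mem _ fun j _ =>
        Submodule.smul_mem _ _ (Submodule.subset_span ⟨j, rfl⟩)
    · obtain ⟨a, rfl⟩ := mem_latticeOf_iff.1 hy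
      refine ⟨a i, ?_⟩
      simp [inner_sum, ← Int.cast_smul_eq_zsmul ℝ, real_inner_smul_right, hDB]
  · rintro w ⟨hw, hw'⟩
    choose a ha using fun i => hw' (B i) (mem_latticeOf B i)
    have hspan : Submodule.span ℝ (Set.range D) = Submodule.span ℝ (Set.range B) := by
      refine Submodule.eq_of_le_of_finrank_eq (Submodule.span_le.2 ?_) ?_
      · rintro _ ⟨i, rfl⟩
        exact Submodule.sum_mem _ fun j _ =>
          Submodule.smul_mem _ _ (Submodule.subset_span ⟨j, rfl⟩)
      · rw [finrank_span_eq_card hB, finrank_span_eq_card hDli]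
    rw [span_latticeOf, ← hspan, Submodule.mem_span_range_iff_exists_fun] at hw
    obtain ⟨e, rfl⟩ := hw
    refine mem_latticeOf_iff.2 ⟨a, Finset.sum_congr rfl fun i _ => ?_⟩
    rw [← Int.cast_smul_eq_zsmul ℝ, ← ha i]
    simp [sum_inner, real_inner_smul_left, hDB]

/-- The coordinates a of w solve G a = g e₀. Cramer's rule gives det G · a₀ = g · det(gram C), while
‖w‖² = g a₀. -/
theorem norm_sq_mul_det_gram_cons {n d : ℕ} {b w : Vec d} {C : Fin n → Vec d} {g : ℝ}
    (hw : w ∈ Submodule.span ℝ (Set.range (Fin.cons b C : Fin (n + 1) → Vec d)))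
    (hb : inner ℝ w b = g) (hC : ∀ i, inner ℝ w (C i) = 0) :
    ‖w‖ ^ 2 * (Matrix.gram ℝ (Fin.cons b C : Fin (n + 1) → Vec d)).det =
      g ^ 2 * (Matrix.gram ℝ C).det := by
  set B : Fin (n + 1) → Vec d := Fin.cons b C with hB
  set G := Matrix.gram ℝ B with hG
  obtain ⟨a, ha⟩ := (Submodule.mem_span_range_iff_exists_fun ℝ).1 hw
  have hGa : G.mulVec a = Pi.single 0 g := by
    ext i
    have h1 : G.mulVec a i = inner ℝ w (B i) := by
      rw [← ha, real_inner_comm]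
      simp [Matrix.mulVec, dotProduct, hG, inner_sum, real_inner_smul_right, mul_comm]
    rw [h1]
    refine Fin.cases ?_ (fun i => ?_) i
    · simp [hB, hb]
    · simp [hB, hC]
  have h0 : G.det * a 0 = g * (Matrix.gram ℝ C).det := by
    have h2 := congrFun (congrArg G.adjugate.mulVec hGa) 0
    rw [Matrix.mulVec_mulVec, Matrix.adjugate_mul, Matrix.smul_mulVec, Matrix.one_mulVec,
      Matrix.mulVec_single, Pi.smul_apply, smul_eq_mul] at h2
    rw [h2]
    have h3 : G.adjugate 0 0 = (Matrix.gram ℝ C).det := by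
      rw [Matrix.adjugate_fin_succ_eq_det_submatrix]
      simp
      rfl
    simp [Matrix.col_apply, h3, mul_comm]
  have hnorm : ‖w‖ ^ 2 = g * a 0 := by
    rw [← real_inner_self_eq_norm_sq]
    nth_rewrite 2 [← ha]
    rw [inner_sum, Fin.sum_univ_succ]
    simp [hB, real_inner_smul_right, hb, hC, mul_comm]
  rw [hnorm]
  linear_combination g * h0

/-- The section of a rank-`n + 1` lattice orthogonal to a nonzero dual vector `w` has rank `n`
and determinant at most `‖w‖` times that of the lattice. -/
theorem exists_orthSection_basis {n d : ℕ} {B : Fin (n + 1) → Vec d}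
    (hB : LinearIndependent ℝ B) {w : Vec d} (hw : w ∈ dualLattice (latticeOf B)) (hw0 : w ≠ 0) :
    ∃ C : Fin n → Vec d, IsLatticeBasis C (orthSection (latticeOf B) w) ∧
      basisDet C ≤ ‖w‖ * basisDet B := by
  -- The values ⟪w, y⟫ on L form an ideal of ℤ. A vector b attaining its generator g splits L as ℤb
  -- ⊕ (L ∩ w^⊥).
  set I : Submodule ℤ ℤ := ((latticeOf B).map ((innerₗ (Vec d) w).restrictScalars ℤ)).comap
    (Algebra.linearMap ℤ ℝ) with hI
  have memI : ∀ m : ℤ, m ∈ I ↔ ∃ y ∈ latticeOf B, inner ℝ w y = (m : ℝ) := by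
    intro m
    simp [hI]
  obtain ⟨g, hg⟩ := (IsPrincipalIdealRing.principal I).principal
  obtain ⟨b, hbL, hb⟩ := (memI g).1 (hg ▸ Submodule.mem_span_singleton_self g)
  have hdvd : ∀ y ∈ latticeOf B, ∃ a : ℤ, inner ℝ w y = (a : ℝ) * g := by
    intro y hy
    obtain ⟨m, hm⟩ := hw.2 y hy
    have : m ∈ I := (memI m).2 ⟨y, hy, hm⟩
    rw [hg, Submodule.mem_span_singleton] at this
    obtain ⟨a, rfl⟩ := this
    exact ⟨a, by simpa using hm⟩
  have hg0 : g ≠ 0 := by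
    rintro rfl
    apply hw0
    have h1 : ∀ y ∈ Submodule.span ℝ (latticeOf B : Set (Vec d)), inner ℝ w y = 0 := by
      intro y hy
      induction hy using Submodule.span_induction with
      | mem y hy => obtain ⟨a, ha⟩ := hdvd y hy; simpa using ha
      | zero => simp
      | add x y _ _ hx hy => rw [inner_add_right, hx, hy, add_zero]
      | smul c x _ hx => rw [real_inner_smul_right, hx, mul_zero]
    exact inner_self_eq_zero.1 (h1 w hw.1)
  have hgR : (g : ℝ) ≠ 0 := by exact_mod_cast hg0
  have hle : orthSection (latticeOf B) w ≤ latticeOf B := inf_le_left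
  obtain ⟨m, c⟩ := Submodule.basisOfPidOfLE hle (Module.Basis.span hB.int_of_real)
  set C : Fin m → Vec d := fun i => (c i : Vec d) with hCdef
  have hCL : latticeOf C = orthSection (latticeOf B) w := by
    have := congrArg (Submodule.map (orthSection (latticeOf B) w).subtype) c.span_eq
    rw [Submodule.map_span, ← Set.range_comp, Submodule.map_top, Submodule.range_subtype] at this
    exact this
  have hCli : LinearIndependent ℤ C :=
    c.linearIndependent.map' (orthSection (latticeOf B) w).subtype (Submodule.ker_subtype _)
  have hCw : ∀ y ∈ latticeOf C, inner ℝ w y = 0 := fun y hy =>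
    (mem_orthSection_iff.1 (hCL ▸ hy)).2
  have hBL : latticeOf (Fin.cons b C : Fin (m + 1) → Vec d) = latticeOf B := by
    refine le_antisymm (Submodule.span_le.2 ?_) fun y hy => ?_
    · rintro _ ⟨i, rfl⟩
      refine Fin.cases hbL (fun i => ?_) i
      exact hle (c i).2
    · obtain ⟨a, ha⟩ := hdvd y hy
      have hmem : y - a • b ∈ latticeOf C := by
        rw [hCL, mem_orthSection_iff]
        refine ⟨Submodule.sub_mem _ hy (Submodule.smul_mem _ _ hbL), ?_⟩
        rw [inner_sub_right, ← Int.cast_smul_eq_zsmul ℝ, real_inner_smul_right, ha, hb, sub_self]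
      rw [latticeOf, Fin.range_cons, Submodule.mem_span_insert]
      exact ⟨a, y - a • b, hmem, by abel⟩
  have hBli : LinearIndependent ℤ (Fin.cons b C : Fin (m + 1) → Vec d) := by
    refine hCli.finCons' b C fun a y hyC hy => ?_
    have h1 := congrArg (fun z => inner ℝ w z) hy
    simp only [inner_add_right, ← Int.cast_smul_eq_zsmul ℝ, real_inner_smul_right, hb,
      hCw _ hyC, inner_zero_right, add_zero, mul_eq_zero, hgR, or_false] at h1
    exact_mod_cast h1
  obtain rfl : m = n := Nat.succ_injective (card_eq_of_linearIndependent_int hB hBli hBL)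
  have hBR := linearIndependent_of_latticeOf_eq hB hBL
  have hCR : LinearIndependent ℝ C := by
    simpa [Function.comp_def] using hBR.comp Fin.succ (Fin.succ_injective _)
  refine ⟨C, ⟨hCR, hCL⟩, ?_⟩
  have hid := norm_sq_mul_det_gram_cons (C := C) (g := g)
    (by rw [← span_latticeOf, hBL]; exact hw.1) hb
    (fun i => hCw _ (mem_latticeOf C i))
  -- Integrality of g is what gives the inequality; equality holds when w is primitive, that is g =
  -- ±1.
  have hg1 : (1 : ℝ) ≤ (g : ℝ) ^ 2 := by
    have : 1 ≤ g ^ 2 := by have := sq_pos_of_ne_zero hg0; omega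
    exact_mod_cast this
  rw [IsLatticeBasis.basisDet_eq (B' := Fin.cons b C) ⟨hB, rfl⟩ ⟨hBR, hBL⟩, basisDet, basisDet]
  refine Real.sqrt_le_iff.2 ⟨by positivity, ?_⟩
  rw [mul_pow, Real.sq_sqrt (det_gram_pos hBR).le, hid]
  nlinarith [det_gram_pos hCR]

/-! ### Gram-Schmidt orthogonalization and LLL-reduced bases. -/

open InnerProductSpace

theorem gramSchmidt_of_val_eq_zero {n d : ℕ} (B : Fin n → Vec d) {i : Fin n} (hi : (i : ℕ) = 0) :
    gramSchmidt ℝ B i = B i := by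
  have : Finset.Iio i = ∅ := by ext j; simp [Fin.lt_def, hi]
  rw [gramSchmidt_def, this, Finset.sum_empty, sub_zero]

theorem gramSchmidt_cons_zero {n d : ℕ} (b : Vec d) (v : Fin n → Vec d) :
    gramSchmidt ℝ (Fin.cons b v : Fin (n + 1) → Vec d) 0 = b :=
  gramSchmidt_of_val_eq_zero _ rfl

/-- The component of `x` orthogonal to `b`. -/
noncomputable def orthComponent {d : ℕ} (b : Vec d) : Vec d →ₗ[ℝ] Vec d :=
  LinearMap.id - (‖b‖ ^ 2)⁻¹ • (innerₗ (Vec d) b).smulRight b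

theorem orthComponent_apply {d : ℕ} (b x : Vec d) :
    orthComponent b x = x - (inner ℝ b x / ‖b‖ ^ 2) • b := by
  simp [orthComponent, smul_smul, div_eq_inv_mul]

theorem orthComponent_self {d : ℕ} {b : Vec d} (hb : b ≠ 0) : orthComponent b b = 0 := by
  rw [orthComponent_apply, real_inner_self_eq_norm_sq, div_self (by positivity), one_smul,
    sub_self]

/-- Projecting away from the first vector commutes with orthogonalization. This lets reducedness be
proved by induction on the rank. -/
theorem gramSchmidt_cons_succ {n d : ℕ} (b : Vec d) (v : Fin n → Vec d) (i : Fin n) :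
    gramSchmidt ℝ (Fin.cons b v : Fin (n + 1) → Vec d) i.succ =
      gramSchmidt ℝ (fun j => orthComponent b (v j)) i := by
  induction i using WellFoundedLT.induction with
  | ind i ih =>
    have h1 := gramSchmidt_def'' ℝ (Fin.cons b v : Fin (n + 1) → Vec d) i.succ
    have h2 := gramSchmidt_def'' ℝ (fun j => orthComponent b (v j)) i
    have hsum : ∀ f : Fin (n + 1) → Vec d,
        ∑ j ∈ Finset.Iio i.succ, f j = f 0 + ∑ j ∈ Finset.Iio i, f j.succ := by
      intro f
      rw [← Finset.filter_gt_eq_Iio, ← Finset.filter_gt_eq_Iio, Finset.sum_filter,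
        Finset.sum_filter, Fin.sum_univ_succ]
      simp
    rw [hsum, gramSchmidt_cons_zero, Fin.cons_succ] at h1
    have h3 : ∀ j ∈ Finset.Iio i,
        (inner ℝ (gramSchmidt ℝ (Fin.cons b v : Fin (n + 1) → Vec d) j.succ) (v i) /
          ((‖gramSchmidt ℝ (Fin.cons b v : Fin (n + 1) → Vec d) j.succ‖ : ℝ)) ^ 2) •
          gramSchmidt ℝ (Fin.cons b v : Fin (n + 1) → Vec d) j.succ =
        (inner ℝ (gramSchmidt ℝ (fun j => orthComponent b (v j)) j) (orthComponent b (v i)) /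
          ((‖gramSchmidt ℝ (fun j => orthComponent b (v j)) j‖ : ℝ)) ^ 2) •
          gramSchmidt ℝ (fun j => orthComponent b (v j)) j := by
      intro j hj
      have horth := gramSchmidt_orthogonal ℝ (Fin.cons b v : Fin (n + 1) → Vec d)
        (Fin.succ_ne_zero j)
      rw [gramSchmidt_cons_zero] at horth
      rw [← ih j (Finset.mem_Iio.1 hj), orthComponent_apply, inner_sub_right,
        real_inner_smul_right, horth, mul_zero, sub_zero]
    have h4 := orthComponent_apply b (v i)
    simp only [RCLike.ofReal_real_eq_id, id_eq] at h1 h2 h3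
    rw [Finset.sum_congr rfl h3] at h1
    rw [eq_sub_of_add_eq h1.symm, eq_sub_of_add_eq h2.symm, h4]
    abel

theorem gsCoeff_cons_succ_succ {n d : ℕ} (b : Vec d) (v : Fin n → Vec d) (i j : Fin n) :
    gsCoeff (Fin.cons b v : Fin (n + 1) → Vec d) i.succ j.succ =
      gsCoeff (fun j => orthComponent b (v j)) i j := by
  have horth := gramSchmidt_orthogonal ℝ (Fin.cons b v : Fin (n + 1) → Vec d)
    (Fin.succ_ne_zero i)
  rw [gramSchmidt_cons_zero] at horth
  rw [gsCoeff, gsCoeff, ← gramSchmidt_cons_succ, Fin.cons_succ, orthComponent_apply,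
    inner_sub_right, real_inner_smul_right, horth, mul_zero, sub_zero]

theorem gsCoeff_cons_zero_succ {n d : ℕ} (b : Vec d) (v : Fin n → Vec d) (j : Fin n) :
    gsCoeff (Fin.cons b v : Fin (n + 1) → Vec d) 0 j.succ = inner ℝ b (v j) / ‖b‖ ^ 2 := by
  rw [gsCoeff, gramSchmidt_cons_zero, Fin.cons_succ]

theorem gsCoeff_of_lt {n d : ℕ} (B : Fin n → Vec d) {i j : Fin n} (h : j < i) :
    gsCoeff B i j = 0 := by
  rw [gsCoeff, gramSchmidt_inv_triangular ℝ B h, zero_div]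

theorem exists_shortest_vector {n d : ℕ} {B : Fin (n + 1) → Vec d}
    (hB : LinearIndependent ℝ B) :
    ∃ b ∈ latticeOf B, b ≠ 0 ∧ ∀ y ∈ latticeOf B, y ≠ 0 → ‖b‖ ≤ ‖y‖ := by
  -- Completing `B` to a basis of the whole space puts the lattice inside a full-rank one, which
  -- meets every ball in finitely many points.
  let e := Module.Basis.extend hB.linearIndepOn_id
  have hfin : Finite (hB.linearIndepOn_id.extend (Set.subset_univ (Set.range B))) :=
    Module.Finite.finite_basis e
  have hle : latticeOf B ≤ Submodule.span ℤ (Set.range e) := by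
    refine Submodule.span_mono ?_
    rw [Module.Basis.range_extend]
    exact Module.Basis.subset_extend hB.linearIndepOn_id
  have hS : {y : Vec d | y ∈ latticeOf B ∧ y ≠ 0 ∧ ‖y‖ ≤ ‖B 0‖}.Finite := by
    refine (ZSpan.setFinite_inter e (s := Metric.closedBall 0 ‖B 0‖)
      Metric.isBounded_closedBall).subset ?_
    rintro y ⟨hy, -, hy'⟩
    exact ⟨by simpa using hy', hle hy⟩
  obtain ⟨b, ⟨hbL, hb0, hb⟩, hmin⟩ := Set.exists_min_image _ (fun y => ‖y‖) hS
    ⟨B 0, mem_latticeOf B 0, hB.ne_zero 0, le_rfl⟩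
  refine ⟨b, hbL, hb0, fun y hy hy0 => ?_⟩
  rcases le_total ‖y‖ ‖B 0‖ with h | h
  · exact hmin y ⟨hy, hy0, h⟩
  · exact hb.trans h

/-- Lifting a basis of the projection of a lattice orthogonally to a shortest vector `b` gives,
together with `b`, generators of the lattice. -/
theorem latticeOf_cons_eq {n d : ℕ} {L : Submodule ℤ (Vec d)} {b : Vec d} {v : Fin n → Vec d}
    (hbL : b ∈ L) (hb0 : b ≠ 0) (hmin : ∀ y ∈ L, y ≠ 0 → ‖b‖ ≤ ‖y‖) (hv : ∀ i, v i ∈ L)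
    (h : latticeOf (fun i => orthComponent b (v i)) =
      L.map ((orthComponent b).restrictScalars ℤ)) :
    latticeOf (Fin.cons b v : Fin (n + 1) → Vec d) = L := by
  refine le_antisymm (Submodule.span_le.2 ?_) fun y hy => ?_
  · rintro _ ⟨i, rfl⟩
    exact Fin.cases hbL hv i
  · have hPy : orthComponent b y ∈ latticeOf (fun i => orthComponent b (v i)) :=
      h ▸ ⟨y, hy, rfl⟩
    obtain ⟨a, ha⟩ := mem_latticeOf_iff.1 hPy
    set x := ∑ i, a i • v i with hx
    have hxv : x ∈ Submodule.span ℤ (Set.range v) :=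
      Submodule.sum_mem _ fun i _ => Submodule.smul_mem _ _ (Submodule.subset_span ⟨i, rfl⟩)
    have hxL : x ∈ L := Submodule.sum_mem _ fun i _ => Submodule.smul_mem _ _ (hv i)
    have hPx : orthComponent b (y - x) = 0 := by
      rw [map_sub, ← ha, hx, map_sum, sub_eq_zero]
      exact Finset.sum_congr rfl fun i _ => (map_zsmul _ _ _).symm
    rw [orthComponent_apply, sub_eq_zero] at hPx
    set r := inner ℝ b (y - x) / ‖b‖ ^ 2
    -- This lattice vector is (r - round r) b, of length at most ‖b‖ / 2, so minimality of b forces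
    -- it to vanish.
    have hz : y - x - round r • b = 0 := by
      by_contra hne
      have h1 := hmin _ (Submodule.sub_mem _ (Submodule.sub_mem _ hy hxL)
        (Submodule.smul_mem _ (round r) hbL)) hne
      rw [hPx, ← Int.cast_smul_eq_zsmul ℝ, ← sub_smul, norm_smul, Real.norm_eq_abs] at h1
      have h2 := abs_sub_round r
      have h3 : 0 < ‖b‖ := norm_pos_iff.2 hb0
      nlinarith
    rw [latticeOf, Fin.range_cons, Submodule.mem_span_insert]
    exact ⟨round r, x, hxv, by rw [← sub_eq_zero, ← hz]; abel⟩

/-- No termination analysis of LLL is needed: take a shortest vector b, reduce the projection of L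
orthogonal to b by induction, and lift that basis with size reduction against b. -/
theorem exists_lllReduced_basis {n d : ℕ} {B : Fin n → Vec d} (hB : LinearIndependent ℝ B) :
    ∃ B' : Fin n → Vec d, IsLatticeBasis B' (latticeOf B) ∧ IsLLLReduced B' := by
  induction n with
  | zero => exact ⟨B, ⟨hB, rfl⟩, hB, fun i => i.elim0, fun i => i.elim0⟩
  | succ n ih =>
    obtain ⟨b, hbL, hb0, hmin⟩ := exists_shortest_vector hB
    set L := latticeOf B with hL
    set L' := L.map ((orthComponent b).restrictScalars ℤ) with hL'
    have hfg : L'.FG := (Submodule.fg_span (Set.finite_range B)).map _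
    have : Module.Finite ℤ L' := Module.Finite.iff_fg.2 hfg
    have : Module.IsTorsionFree ℤ (Vec d) := .trans_faithfulSMul ℤ ℝ _
    have : Module.IsTorsionFree ℤ L' :=
      Function.Injective.moduleIsTorsionFree _ L'.injective_subtype (fun _ _ => rfl)
    obtain ⟨m, c⟩ := Module.basisOfFiniteTypeTorsionFree' (R := ℤ) (M := L')
    have hcL : latticeOf (fun i => (c i : Vec d)) = L' := by
      have := congrArg (Submodule.map L'.subtype) c.span_eq
      rw [Submodule.map_span, ← Set.range_comp, Submodule.map_top,
        Submodule.range_subtype] at this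
      exact this
    have hcli : LinearIndependent ℤ (fun i => (c i : Vec d)) :=
      c.linearIndependent.map' L'.subtype (Submodule.ker_subtype _)
    choose v hvL hv using fun i => (c i).2
    replace hv : ∀ i, orthComponent b (v i) = c i := hv
    have hBv : latticeOf (Fin.cons b v : Fin (m + 1) → Vec d) = L :=
      latticeOf_cons_eq hbL hb0 hmin hvL (by simpa only [hv] using hcL)
    have hvli : LinearIndependent ℤ (Fin.cons b v : Fin (m + 1) → Vec d) := by
      rw [Fintype.linearIndependent_iff] at hcli ⊢
      intro g hg
      rw [Fin.sum_univ_succ] at hg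
      have hgs : ∀ i : Fin m, g i.succ = 0 := by
        refine hcli (fun i => g i.succ) ?_
        have := congrArg (orthComponent b) hg
        simpa [map_zsmul, orthComponent_self hb0, hv] using this
      refine fun i => Fin.cases ?_ hgs i
      simpa [hgs, hb0] using hg
    obtain rfl : m = n := Nat.succ_injective (card_eq_of_linearIndependent_int hB hvli hBv)
    have hvR := linearIndependent_of_latticeOf_eq hB hBv
    -- Projections of lattices need not be discrete in general. Here real independence comes from
    -- that of b and the lifts, by adding the right multiple of b to a relation.
    have hcR : LinearIndependent ℝ (fun i => (c i : Vec d)) := by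
      rw [Fintype.linearIndependent_iff] at hvR ⊢
      intro g hg i
      have := hvR (Fin.cons (-∑ i, g i * (inner ℝ b (v i) / ‖b‖ ^ 2)) g) (by
        rw [Fin.sum_univ_succ]
        simp only [← hv, orthComponent_apply, smul_sub, Finset.sum_sub_distrib, smul_smul,
          ← Finset.sum_smul] at hg
        simp only [Fin.cons_zero, Fin.cons_succ, neg_smul]
        rw [neg_add_eq_sub, hg]) i.succ
      simpa using this
    obtain ⟨c', ⟨hc'R, hc'L⟩, -, hsize, hlov⟩ := ih hcR
    rw [hcL] at hc'L
    have hlift : ∀ i, ∃ u ∈ L, orthComponent b u = c' i ∧ |inner ℝ b u / ‖b‖ ^ 2| ≤ 1 / 2 := by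
      intro i
      obtain ⟨x, hxL, hx⟩ : c' i ∈ L' := hc'L ▸ mem_latticeOf c' i
      replace hx : orthComponent b x = c' i := hx
      set r := inner ℝ b x / ‖b‖ ^ 2 with hr
      refine ⟨x - round r • b, Submodule.sub_mem _ hxL (Submodule.smul_mem _ _ hbL), ?_, ?_⟩
      · rw [map_sub, map_zsmul, orthComponent_self hb0, smul_zero, sub_zero, hx]
      · have : inner ℝ b (x - round r • b) / ‖b‖ ^ 2 = r - round r := by
          have : ‖b‖ ≠ 0 := norm_ne_zero_iff.2 hb0
          rw [inner_sub_right, ← Int.cast_smul_eq_zsmul ℝ, real_inner_smul_right,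
            real_inner_self_eq_norm_sq, sub_div, ← hr]
          field_simp
        rw [this]
        exact abs_sub_round r
    choose u huL hu hu2 using hlift
    have hu' : (fun i => orthComponent b (u i)) = c' := funext hu
    have hBu : latticeOf (Fin.cons b u : Fin (m + 1) → Vec d) = L :=
      latticeOf_cons_eq hbL hb0 hmin huL (by rw [hu', hc'L])
    have huR := linearIndependent_of_latticeOf_eq hB hBu
    refine ⟨Fin.cons b u, ⟨huR, hBu⟩, huR, fun i j => ?_, fun i j => ?_⟩
    · refine Fin.cases (fun hij => ?_) (fun i => ?_) i
      · refine Fin.cases (fun hij => absurd rfl hij) (fun j _ => ?_) j hij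
        rw [gsCoeff_cons_zero_succ]
        exact hu2 j
      · refine Fin.cases (fun _ => ?_) (fun j hij => ?_) j
        · rw [gsCoeff_of_lt _ (Fin.succ_pos i)]
          norm_num
        · rw [gsCoeff_cons_succ_succ, hu']
          exact hsize i j fun h => hij (h ▸ rfl)
    · refine Fin.cases (fun hij => by simp at hij) (fun j => ?_) j
      refine Fin.cases (fun hij => ?_) (fun i hij => ?_) i
      · rw [gsCoeff_cons_zero_succ, gramSchmidt_cons_zero, gramSchmidt_cons_succ, hu']
        rw [gramSchmidt_of_val_eq_zero c' (by simpa using hij), ← hu, orthComponent_apply]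
        set x := u j
        have hx0 : x ≠ 0 := by
          have := huR.ne_zero j.succ
          simpa [x] using this
        have h2 := hmin x (huL _) hx0
        have h3 : ‖b‖ ≠ 0 := norm_ne_zero_iff.2 hb0
        -- By Pythagoras the right side of the first Lovász condition is ‖x‖², which is at least
        -- ‖b‖² by minimality.
        have h4 : ‖x - (inner ℝ b x / ‖b‖ ^ 2) • b‖ ^ 2 + (inner ℝ b x / ‖b‖ ^ 2) ^ 2 * ‖b‖ ^ 2 =
            ‖x‖ ^ 2 := by
          rw [norm_sub_sq_real, norm_smul, real_inner_smul_right, real_inner_comm, mul_pow,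
            Real.norm_eq_abs, sq_abs]
          field_simp
          ring
        rw [h4]
        nlinarith [norm_nonneg b]
      · rw [gsCoeff_cons_succ_succ, gramSchmidt_cons_succ, gramSchmidt_cons_succ, hu']
        exact hlov i j (by simpa using hij)

/-- The change of basis to the Gram-Schmidt vectors is unitriangular. -/
theorem det_gram_eq_prod_gramSchmidt {n d : ℕ} (B : Fin n → Vec d) :
    (Matrix.gram ℝ B).det = ∏ i, ‖gramSchmidt ℝ B i‖ ^ 2 := by
  set U : Matrix (Fin n) (Fin n) ℝ := fun i j =>
    if j < i then gsCoeff B j i else if j = i then 1 else 0 with hU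
  have h : ∀ i, B i = ∑ j, U i j • gramSchmidt ℝ B j := by
    intro i
    conv_lhs => rw [gramSchmidt_def'' ℝ B i]
    have : ∀ j, U i j • gramSchmidt ℝ B j =
        (if j = i then gramSchmidt ℝ B j else 0) +
          if j < i then gsCoeff B j i • gramSchmidt ℝ B j else 0 := by
      intro j
      rcases lt_trichotomy j i with h | h | h
      · simp [hU, h, h.ne]
      · simp [hU, h]
      · simp [hU, h.not_gt, h.ne']
    simp only [this, Finset.sum_add_distrib, Finset.sum_ite_eq', Finset.mem_univ, if_true]
    rw [← Finset.sum_filter, Finset.filter_gt_eq_Iio]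
    rfl
  have hUdet : U.det = 1 := by
    rw [Matrix.det_of_isLowerTriangular]
    · simp [hU]
    · intro i j hij
      have hij' : i < j := hij
      simp [hU, hij'.not_gt, hij'.ne']
  have hdiag : Matrix.gram ℝ (gramSchmidt ℝ B) =
      Matrix.diagonal fun i => ‖gramSchmidt ℝ B i‖ ^ 2 := by
    ext i j
    rcases eq_or_ne i j with rfl | hij
    · simp
    · simp [Matrix.diagonal_apply_ne _ hij, gramSchmidt_orthogonal ℝ B hij]
  rw [gram_linearCombination h, Matrix.det_mul, Matrix.det_mul, Matrix.det_transpose, hUdet, hdiag,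
    Matrix.det_diagonal, one_mul, mul_one]

/-- The first vector of an LLL-reduced basis of rank `n + 1` has length at most
`2^(n/4) det^(1/(n+1))`. -/
theorem IsLLLReduced.norm_zero_le {n d : ℕ} {B : Fin (n + 1) → Vec d} (hB : IsLLLReduced B) :
    ‖B 0‖ ≤ (2 : ℝ) ^ ((n : ℝ) / 4) * basisDet B ^ (1 / ((n + 1 : ℕ) : ℝ)) := by
  obtain ⟨hli, hsize, hlov⟩ := hB
  have hstep : ∀ i : ℕ, ∀ hi : i < n + 1,
      ‖B 0‖ ^ 2 ≤ 2 ^ i * ‖gramSchmidt ℝ B ⟨i, hi⟩‖ ^ 2 := by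
    intro i
    induction i with
    | zero =>
      intro hi
      have : (⟨0, hi⟩ : Fin (n + 1)) = 0 := rfl
      simp [this, gramSchmidt_of_val_eq_zero B (i := 0) rfl]
    | succ i ih =>
      intro hi
      have h1 := ih (by omega)
      have h2 := hlov ⟨i, by omega⟩ ⟨i + 1, hi⟩ rfl
      have h3 := sq_le_sq' (neg_le_of_abs_le (hsize ⟨i, by omega⟩ ⟨i + 1, hi⟩ (by simp)))
        (le_of_abs_le (hsize ⟨i, by omega⟩ ⟨i + 1, hi⟩ (by simp)))
      set x := ‖gramSchmidt ℝ B ⟨i, by omega⟩‖ ^ 2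
      set y := ‖gramSchmidt ℝ B ⟨i + 1, hi⟩‖ ^ 2
      have hx : 0 ≤ x := sq_nonneg _
      -- The factor is 1 / (3/4 - 1/4), from the Lovász condition and μ² ≤ 1/4.
      have h4 : x ≤ 2 * y := by nlinarith [mul_le_mul_of_nonneg_right h3 hx]
      calc ‖B 0‖ ^ 2 ≤ 2 ^ i * x := h1
        _ ≤ 2 ^ i * (2 * y) := by gcongr
        _ = 2 ^ (i + 1) * y := by ring
  have hprod : (‖B 0‖ ^ 2) ^ (n + 1) ≤ 2 ^ (∑ i ∈ Finset.range (n + 1), i) * basisDet B ^ 2 := by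
    rw [basisDet, Real.sq_sqrt (det_gram_pos hli).le, det_gram_eq_prod_gramSchmidt,
      ← Finset.prod_pow_eq_pow_sum, Finset.prod_range, ← Finset.prod_mul_distrib,
      ← Fin.prod_const]
    exact Finset.prod_le_prod (fun _ _ => by positivity) fun i _ => hstep i i.2
  have hsum : (∑ i ∈ Finset.range (n + 1), i) * 2 = (n + 1) * n := Finset.sum_range_id_mul_two _
  have hD := (basisDet_pos hli).le
  -- This power clears both denominators, 4 and n + 1, in the exponents.
  refine le_of_pow_le_pow_left₀ (n := 4 * (n + 1)) (by positivity) (by positivity) ?_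
  have hn : ((n + 1 : ℕ) : ℝ) ≠ 0 := by positivity
  calc ‖B 0‖ ^ (4 * (n + 1)) = ((‖B 0‖ ^ 2) ^ (n + 1)) ^ 2 := by
        rw [← pow_mul, ← pow_mul]; congr 1; ring
    _ ≤ (2 ^ (∑ i ∈ Finset.range (n + 1), i) * basisDet B ^ 2) ^ 2 := by gcongr
    _ = 2 ^ ((n + 1) * n) * basisDet B ^ 4 := by rw [mul_pow, ← pow_mul, ← pow_mul, hsum]
    _ = ((2 : ℝ) ^ ((n : ℝ) / 4) * basisDet B ^ (1 / ((n + 1 : ℕ) : ℝ))) ^ (4 * (n + 1)) := by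
        rw [mul_pow, ← Real.rpow_mul_natCast zero_le_two, ← Real.rpow_mul_natCast hD,
          ← Real.rpow_natCast 2, ← Real.rpow_natCast (basisDet B)]
        congr 2
        · push_cast; ring
        · push_cast; field_simp

/-! ### HSVP solutions and one step of the reduction. -/

theorem IsHSVPSolution.of_isLatticeBasis {n d : ℕ} {γ : ℝ} {B B' : Fin n → Vec d}
    {L : Submodule ℤ (Vec d)} {y : Vec d} (h : IsHSVPSolution γ B y) (hB : IsLatticeBasis B L)
    (hB' : IsLatticeBasis B' L) : IsHSVPSolution γ B' y :=
  ⟨hB'.2 ▸ hB.2 ▸ h.1, h.2.1, hB.basisDet_eq hB' ▸ h.2.2⟩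

theorem IsHSVPSolution.mono {n d : ℕ} {γ γ' : ℝ} {B : Fin n → Vec d} {y : Vec d}
    (h : IsHSVPSolution γ B y) (hγ : γ ≤ γ') : IsHSVPSolution γ' B y :=
  ⟨h.1, h.2.1, h.2.2.trans
    (mul_le_mul_of_nonneg_right hγ (Real.rpow_nonneg (Real.sqrt_nonneg _) _))⟩

/-- On a copy of ℤ^k the oracle must return a nonzero integer vector, whose length is at least 1.
This avoids proving that the supremum defining δ_k is over a bounded set. -/
theorem one_le_hermiteConst_of_oracle {k d : ℕ} {O : (Fin k → Vec d) → Vec d}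
    (hO : IsHSVPOracle (Real.sqrt (hermiteConst k)) O) (hkd : k ≤ d) : 1 ≤ hermiteConst k := by
  set B : Fin k → Vec d := fun i => EuclideanSpace.single (Fin.castLE hkd i) 1
  have hon : Orthonormal ℝ B :=
    (EuclideanSpace.orthonormal_single (𝕜 := ℝ) (ι := Fin d)).comp _ (Fin.castLE_injective hkd)
  have hdet : basisDet B = 1 := by
    rw [basisDet, Matrix.gram_eq_one_iff_orthonormal.2 hon, Matrix.det_one, Real.sqrt_one]
  obtain ⟨hmem, hne, hle⟩ := hO B hon.linearIndependent
  rw [hdet, Real.one_rpow, mul_one] at hle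
  obtain ⟨a, ha⟩ := mem_latticeOf_iff.1 hmem
  obtain ⟨i, hi⟩ : ∃ i, a i ≠ 0 := by
    by_contra! h
    exact hne (by simp [← ha, h])
  have h1 : inner ℝ (B i) (O B) = (a i : ℝ) := by
    rw [← ha]
    simp only [← Int.cast_smul_eq_zsmul ℝ]
    exact hon.inner_right_fintype (fun j => (a j : ℝ)) i
  have h2 := abs_real_inner_le_norm (B i) (O B)
  rw [h1, hon.1 i, one_mul] at h2
  have h3 : (1 : ℝ) ≤ |(a i : ℝ)| := by exact_mod_cast Int.one_le_abs hi
  exact Real.one_le_sqrt.1 ((h3.trans h2).trans hle)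

theorem IsHSVPSolution.of_section {n d : ℕ} (hn : 0 < n) {γ₁ γ₂ : ℝ} (hγ₁ : 0 ≤ γ₁)
    (hγ₂ : 0 ≤ γ₂) {B D : Fin (n + 1) → Vec d} {C : Fin n → Vec d} {w y : Vec d}
    (hB : LinearIndependent ℝ B) (hD : basisDet D = (basisDet B)⁻¹)
    (hC : IsLatticeBasis C (orthSection (latticeOf B) w))
    (hCdet : basisDet C ≤ ‖w‖ * basisDet B)
    (hw : IsHSVPSolution γ₁ D w) (hy : IsHSVPSolution γ₂ C y) :
    IsHSVPSolution (γ₂ * γ₁ ^ (1 / (n : ℝ))) B y := by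
  have hpos := basisDet_pos hB
  have hn' : (n : ℝ) ≠ 0 := by positivity
  refine ⟨(mem_orthSection_iff.1 (hC.2 ▸ hy.1)).1, hy.2.1, hy.2.2.trans ?_⟩
  rw [mul_assoc]
  refine mul_le_mul_of_nonneg_left ?_ hγ₂
  have h1 : basisDet C ≤ γ₁ * basisDet B ^ ((n : ℝ) / ((n + 1 : ℕ) : ℝ)) := by
    calc basisDet C ≤ ‖w‖ * basisDet B := hCdet
      _ ≤ (γ₁ * (basisDet B)⁻¹ ^ (1 / ((n + 1 : ℕ) : ℝ))) * basisDet B := by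
        rw [← hD]; gcongr; exact hw.2.2
      _ = γ₁ * basisDet B ^ ((n : ℝ) / ((n + 1 : ℕ) : ℝ)) := by
        rw [Real.inv_rpow hpos.le, ← Real.rpow_neg hpos.le, mul_assoc]
        nth_rewrite 2 [← Real.rpow_one (basisDet B)]
        rw [← Real.rpow_add hpos]
        congr 2
        push_cast
        field_simp
        ring
  calc basisDet C ^ (1 / (n : ℝ))
      ≤ (γ₁ * basisDet B ^ ((n : ℝ) / ((n + 1 : ℕ) : ℝ))) ^ (1 / (n : ℝ)) :=
        Real.rpow_le_rpow (basisDet_pos hC.1).le h1 (by positivity)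
    _ = γ₁ ^ (1 / (n : ℝ)) * basisDet B ^ (1 / ((n + 1 : ℕ) : ℝ)) := by
        rw [Real.mul_rpow hγ₁ (by positivity), ← Real.rpow_mul hpos.le]
        congr 2
        field_simp

/-! ### The recursion for the approximation factor. -/

/-- The exponent of two in the approximation factor of the reduction. -/
noncomputable def slackExponent (n τ : ℕ) : ℝ :=
  if τ = 0 then ((n : ℝ) - 1) / 4 else (n : ℝ) * (n - 1) * (n - 2) / 2 ^ τ

/-- The approximation factor of the reduction, as a function of `δ = δ_k`. -/
noncomputable def approxFactor (δ : ℝ) (k n τ : ℕ) : ℝ :=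
  δ ^ (((n : ℝ) - 1) / (2 * ((k : ℝ) - 1))) * 2 ^ slackExponent n τ

theorem slackExponent_nonneg {n : ℕ} (hn : 2 ≤ n) (τ : ℕ) : 0 ≤ slackExponent n τ := by
  have : (2 : ℝ) ≤ n := by exact_mod_cast hn
  rw [slackExponent]
  split_ifs
  · linarith
  · exact div_nonneg (mul_nonneg (mul_nonneg (by linarith) (by linarith)) (by linarith))
      (by positivity)

theorem slackExponent_le {n : ℕ} (hn : 2 ≤ n) (τ : ℕ) :
    slackExponent n τ ≤ (n : ℝ) ^ 3 / (2 : ℝ) ^ τ := by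
  have h : (2 : ℝ) ≤ n := by exact_mod_cast hn
  rw [slackExponent]
  split_ifs with h0
  · subst h0
    have : (1 : ℝ) ≤ (n : ℝ) ^ 2 := one_le_pow₀ (by linarith)
    rw [pow_zero, div_one]
    nlinarith
  · gcongr
    nlinarith

/-- For τ ≥ 1, after clearing 2^(τ+1) and dividing by n - 1, this is n² + 2 ≤ n² + n, tight at n =
2. For τ = 0 the LLL exponent n/4 contributes only 1/4. -/
theorem slackExponent_step {n : ℕ} (hn : 2 ≤ n) (τ : ℕ) :
    slackExponent n (τ + 1) + slackExponent (n + 1) τ / n ≤ slackExponent (n + 1) (τ + 1) := by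
  have h : (2 : ℝ) ≤ n := by exact_mod_cast hn
  have h0 : (0 : ℝ) < n := by linarith
  rcases τ with _ | τ
  · simp only [slackExponent, zero_add, one_ne_zero, if_false, if_true, pow_one]
    push_cast
    have : ((n : ℝ) + 1 - 1) / 4 / n = 1 / 4 := by field_simp; ring
    rw [this]
    nlinarith
  · simp only [slackExponent, Nat.add_eq_zero_iff, one_ne_zero, and_false, if_false]
    push_cast
    have : ((n : ℝ) + 1) * (n + 1 - 1) * (n + 1 - 2) / 2 ^ (τ + 1) / n =
        2 * ((n + 1) * (n - 1)) / 2 ^ (τ + 1 + 1) := by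
      field_simp
      ring
    rw [this, ← add_div]
    gcongr
    nlinarith [mul_nonneg (sub_nonneg.2 h) (by linarith : (0 : ℝ) ≤ (n : ℝ) - 1)]

theorem approxFactor_nonneg {δ : ℝ} (hδ : 1 ≤ δ) (k n τ : ℕ) : 0 ≤ approxFactor δ k n τ := by
  have : 0 < δ := by linarith
  rw [approxFactor]
  positivity

theorem approxFactor_step {δ : ℝ} (hδ : 1 ≤ δ) {k n : ℕ} (hn : 2 ≤ n) (τ : ℕ) :
    approxFactor δ k n (τ + 1) * approxFactor δ k (n + 1) τ ^ (1 / (n : ℝ)) ≤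
      approxFactor δ k (n + 1) (τ + 1) := by
  have hδ0 : 0 < δ := by linarith
  have hn0 : (n : ℝ) ≠ 0 := by positivity
  rw [approxFactor, approxFactor, approxFactor, Real.mul_rpow (by positivity) (by positivity),
    ← Real.rpow_mul hδ0.le, ← Real.rpow_mul zero_le_two, mul_mul_mul_comm, ← Real.rpow_add hδ0,
    ← Real.rpow_add zero_lt_two]
  have h1 : ((n : ℝ) - 1) / (2 * ((k : ℝ) - 1)) +
      (((n + 1 : ℕ) : ℝ) - 1) / (2 * ((k : ℝ) - 1)) * (1 / (n : ℝ)) =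
      (((n + 1 : ℕ) : ℝ) - 1) / (2 * ((k : ℝ) - 1)) := by
    push_cast
    rw [add_sub_cancel_right, mul_one_div, div_right_comm, div_self hn0, ← add_div, sub_add_cancel]
  rw [h1, mul_one_div]
  gcongr
  · norm_num
  · exact slackExponent_step hn τ

theorem sqrt_le_approxFactor (δ : ℝ) {k : ℕ} (hk : 2 ≤ k) (τ : ℕ) :
    Real.sqrt δ ≤ approxFactor δ k k τ := by
  have h : (2 : ℝ) ≤ k := by exact_mod_cast hk
  have h1 : ((k : ℝ) - 1) / (2 * ((k : ℝ) - 1)) = 1 / 2 := by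
    have : (k : ℝ) - 1 ≠ 0 := by linarith
    field_simp
  rw [approxFactor, h1, ← Real.sqrt_eq_rpow]
  exact le_mul_of_one_le_right (Real.sqrt_nonneg _)
    (Real.one_le_rpow one_le_two (slackExponent_nonneg hk τ))

/-! ### Operation counts and the analysis of runs. -/

theorem choose_recursion (m τ : ℕ) :
    (m + (τ + 1)).choose τ + (m + (τ + 1)).choose (τ + 1) = (m + 1 + (τ + 1)).choose (τ + 1) := by
  rw [show m + 1 + (τ + 1) = (m + (τ + 1)) + 1 by ring, Nat.choose_succ_succ]

/-- The number of oracle calls of the reduction with excess rank `m = n - k`. -/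
def oracleCalls (m : ℕ) : ℕ → ℕ
  | 0 => 0
  | τ + 1 => (m + τ).choose τ

theorem oracleCalls_step (m τ : ℕ) :
    oracleCalls (m + 1) τ + oracleCalls m (τ + 1) = oracleCalls (m + 1) (τ + 1) := by
  rcases τ with _ | τ
  · simp [oracleCalls]
  · rw [oracleCalls, oracleCalls, oracleCalls, Nat.add_right_comm m 1 τ]
    exact choose_recursion m τ

/-- Runs exist, and every run outputs a short vector and has a fixed number of operations. -/
theorem run_spec {k d : ℕ} (hk : 2 ≤ k) {O : (Fin k → Vec d) → Vec d}
    (hO : IsHSVPOracle (Real.sqrt (hermiteConst k)) O) (hδ : 1 ≤ hermiteConst k) (τ m : ℕ)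
    {L : Submodule ℤ (Vec d)} {B : Fin (k + m) → Vec d} (hB : IsLatticeBasis B L) :
    (∃ (y : Vec d) (c t : ℕ), Run O L τ y c t) ∧
    ∀ (y : Vec d) (c t : ℕ), Run O L τ y c t →
      IsHSVPSolution (approxFactor (hermiteConst k) k (k + m) τ) B y ∧
      c = oracleCalls m τ ∧ t + 2 = 3 * (m + τ).choose τ := by
  induction τ generalizing m L with
  | zero =>
    obtain ⟨n, hn⟩ : ∃ n, k + m = n + 1 := ⟨k + m - 1, by omega⟩
    constructor
    · obtain ⟨B', hB', hred⟩ := exists_lllReduced_basis hB.1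
      exact ⟨_, _, _, Run.lll B' (hB.2 ▸ hB') hred (by omega)⟩
    · intro y c t hrun
      cases hrun with
      | lll B' hB' hred hm =>
        refine ⟨?_, rfl, by simp⟩
        obtain rfl := hB.rank_eq hB'
        refine IsHSVPSolution.of_isLatticeBasis (B := B') ?_ hB' hB
        refine ⟨mem_latticeOf _ _, hred.1.ne_zero _, ?_⟩
        clear hB
        -- The rank must become literally n + 1 before the LLL bound on `B 0` applies.
        generalize k + m = N at *
        subst hn
        refine (hred.norm_zero_le).trans (mul_le_mul_of_nonneg_right ?_
          (Real.rpow_nonneg (Real.sqrt_nonneg _) _))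
        rw [approxFactor, slackExponent, if_pos rfl]
        push_cast
        rw [add_sub_cancel_right]
        have hk1 : (0 : ℝ) ≤ (k : ℝ) - 1 := by
          have : (2 : ℝ) ≤ k := by exact_mod_cast hk
          linarith
        exact le_mul_of_one_le_left (by positivity)
          (Real.one_le_rpow hδ (by positivity))
  | succ τ ihτ =>
    -- The dual call lowers τ at the same rank and the section call lowers m at the same τ, so this
    -- induction sits inside the one on τ.
    induction m generalizing L with
    | zero =>
      constructor
      · exact ⟨_, _, _, Run.oracle B hB⟩
      · intro y c t hrun
        cases hrun with
        | oracle B' hB' =>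
          exact ⟨((hO B' hB'.1).of_isLatticeBasis hB' hB).mono (sqrt_le_approxFactor _ hk _),
            by simp [oracleCalls], by simp⟩
        | step hrank => exact absurd ⟨B, hB⟩ hrank
    | succ m ihm =>
      have hrank : ¬ HasRank L k := fun ⟨B', hB'⟩ => by
        have := hB.rank_eq hB'
        omega
      obtain ⟨D, hD, hDdet⟩ := exists_dual_basis hB.1
      rw [hB.2] at hD
      have hw := ihτ (m + 1) hD
      have hsec : ∀ w c t, Run O (dualLattice L) τ w c t →
          ∃ C : Fin (k + m) → Vec d, IsLatticeBasis C (orthSection L w) ∧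
            basisDet C ≤ ‖w‖ * basisDet B := by
        intro w c t hrun
        have h := (hw.2 w c t hrun).1
        have := exists_orthSection_basis (n := k + m) hB.1 (w := w)
          (by rw [hB.2, ← hD.2]; exact h.1) h.2.1
        rwa [hB.2] at this
      constructor
      · obtain ⟨w, c₁, t₁, hrun⟩ := hw.1
        obtain ⟨C, hC, -⟩ := hsec w c₁ t₁ hrun
        obtain ⟨y, c₂, t₂, hrun'⟩ := (ihm hC).1
        exact ⟨_, _, _, Run.step hrank hrun hrun'⟩
      · intro y c t hrun
        cases hrun with
        | oracle B' hB' => exact absurd ⟨B', hB'⟩ hrank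
        | step _ hrun hrun' =>
          obtain ⟨C, hC, hCdet⟩ := hsec _ _ _ hrun
          obtain ⟨hw1, rfl, hw3⟩ := hw.2 _ _ _ hrun
          obtain ⟨hy1, rfl, hy3⟩ := (ihm hC).2 _ _ _ hrun'
          refine ⟨?_, oracleCalls_step m τ, ?_⟩
          · exact (IsHSVPSolution.of_section (n := k + m) (by omega)
              (approxFactor_nonneg hδ _ _ _) (approxFactor_nonneg hδ _ _ _) hB.1 hDdet
              (hB.2 ▸ hC) hCdet hw1 hy1).mono (approxFactor_step hδ (by omega) τ)
          -- The shift by 2 absorbs the dual and section computations: t + 2 is additive, with value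
          -- 3 at the leaves.
          · have := choose_recursion m τ
            rw [show m + 1 + τ = m + (τ + 1) by ring] at hw3
            omega

/-! ### Quasipolynomial bounds on the binomial coefficients. -/

theorem choose_le_pow (m s : ℕ) : (m + s).choose s ≤ (m + 1) ^ s := by
  induction s with
  | zero => simp
  | succ s ih =>
    have h := Nat.add_one_mul_choose_eq (m + s) s
    have h2 : m + s + 1 ≤ (m + 1) * (s + 1) := by nlinarith
    refine Nat.le_of_mul_le_mul_right (c := s + 1) ?_ s.succ_pos
    calc (m + (s + 1)).choose (s + 1) * (s + 1) = (m + s + 1) * (m + s).choose s := h.symm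
      _ ≤ ((m + 1) * (s + 1)) * (m + 1) ^ s := Nat.mul_le_mul h2 ih
      _ = (m + 1) ^ (s + 1) * (s + 1) := by ring

/-- The binomial coefficient is the product of the factors 1 + m/j for 1 ≤ j ≤ s, each at least 1 +
a. -/
theorem pow_le_choose_of_mul_le {a : ℝ} (ha : 0 ≤ a) (m s : ℕ) (h : a * s ≤ m) :
    (1 + a) ^ s ≤ ((m + s).choose s : ℝ) := by
  induction s with
  | zero => simp
  | succ s ih =>
    push_cast at h
    have h1 := ih (by linarith)
    have h2 : ((m : ℝ) + s + 1) * ((m + s).choose s : ℝ) =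
        ((m + (s + 1)).choose (s + 1) : ℝ) * (s + 1) := by
      exact_mod_cast Nat.add_one_mul_choose_eq (m + s) s
    have hs : (0 : ℝ) < (s : ℝ) + 1 := by positivity
    refine le_of_mul_le_mul_right ?_ hs
    rw [← h2]
    calc (1 + a) ^ (s + 1) * (s + 1) = ((1 + a) * (s + 1)) * (1 + a) ^ s := by ring
      _ ≤ ((m : ℝ) + s + 1) * ((m + s).choose s : ℝ) :=
        mul_le_mul (by linarith) h1 (by positivity) (by positivity)

/-- With x = √n, Bernoulli's inequality gives x^(1/12) ≤ 1 + x/12, and log₂ n ≤ 2x. -/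
theorem rpow_le_one_add_div_logb {n : ℝ} (hn : 4 ≤ n) :
    n ^ (1 / 24 : ℝ) ≤ 1 + n / (6 * Real.logb 2 n) := by
  have hn0 : 0 < n := by linarith
  set x := Real.sqrt n with hx
  have hx2 : x ^ 2 = n := Real.sq_sqrt hn0.le
  have hx0 : 0 < x := Real.sqrt_pos.2 hn0
  have hlog : Real.logb 2 n ≤ 2 * x := by
    have h1 : Real.logb 2 n = 2 * Real.logb 2 x := by
      rw [← hx2, ← Real.rpow_natCast x 2, Real.logb_rpow_eq_mul_logb_of_pos hx0]
      norm_num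
    have h2 : Real.logb 2 x ≤ x := by
      rw [Real.logb_le_iff_le_rpow one_lt_two hx0]
      have h3 := one_add_mul_self_le_rpow_one_add (s := 1) (by norm_num) (p := x)
        (by rw [hx]; exact Real.one_le_sqrt.2 (by linarith))
      norm_num at h3
      linarith
    linarith
  have hlog0 : 0 < Real.logb 2 n := Real.logb_pos one_lt_two (by linarith)
  calc n ^ (1 / 24 : ℝ) = (1 + (x - 1)) ^ (1 / 12 : ℝ) := by
        rw [add_sub_cancel, hx, Real.sqrt_eq_rpow, ← Real.rpow_mul hn0.le]
        norm_num
    _ ≤ 1 + 1 / 12 * (x - 1) :=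
        rpow_one_add_le_one_add_mul_self (by linarith) (by norm_num) (by norm_num)
    _ ≤ 1 + x / 12 := by linarith
    _ = 1 + n / (6 * (2 * x)) := by rw [← hx2]; field_simp; ring
    _ ≤ 1 + n / (6 * Real.logb 2 n) := by gcongr

theorem oracleCalls_le_choose (m τ : ℕ) : oracleCalls m τ ≤ (m + τ).choose τ := by
  rcases τ with _ | τ
  · simp [oracleCalls]
  · rw [oracleCalls, ← Nat.add_assoc, Nat.choose_succ_succ]
    omega

theorem three_mul_choose_le_rpow {n m : ℕ} (hn : 2 ≤ n) (hm : m + 2 ≤ n) :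
    3 * (((m + ⌈3 * Real.logb 2 n⌉₊).choose ⌈3 * Real.logb 2 n⌉₊ : ℕ) : ℝ) ≤
      (n : ℝ) ^ (6 * Real.logb 2 n) := by
  set τ := ⌈3 * Real.logb 2 n⌉₊ with hτ
  have h2 : (2 : ℝ) ≤ n := by exact_mod_cast hn
  have hlog : 1 ≤ Real.logb 2 n := by
    rw [Real.le_logb_iff_rpow_le one_lt_two (by linarith), Real.rpow_one]
    exact h2
  have hτle : (τ : ℝ) < 3 * Real.logb 2 n + 1 := Nat.ceil_lt_add_one (by linarith)
  have h1 : ((m + τ).choose τ : ℝ) ≤ (n : ℝ) ^ τ := by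
    have := (choose_le_pow m τ).trans (Nat.pow_le_pow_left (by omega : m + 1 ≤ n) τ)
    exact_mod_cast this
  calc 3 * ((m + τ).choose τ : ℝ) ≤ (n : ℝ) ^ 2 * (n : ℝ) ^ τ :=
        mul_le_mul (by nlinarith) h1 (by positivity) (by positivity)
    _ = (n : ℝ) ^ ((2 + τ : ℕ) : ℝ) := by rw [Real.rpow_natCast, pow_add]
    _ ≤ (n : ℝ) ^ (6 * Real.logb 2 n) :=
        Real.rpow_le_rpow_of_exponent_le (by linarith) (by push_cast; linarith)

theorem rpow_le_oracleCalls {n m : ℕ} (hn : 4 ≤ n) (hm : n ≤ 2 * m) :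
    (n : ℝ) ^ ((1 / 12 : ℝ) * Real.logb 2 n) ≤
      (oracleCalls m ⌈3 * Real.logb 2 n⌉₊ : ℝ) := by
  have hn' : (4 : ℝ) ≤ n := by exact_mod_cast hn
  have hm' : (n : ℝ) ≤ 2 * m := by exact_mod_cast hm
  set l := Real.logb 2 n with hl
  have hlog : 1 ≤ l := by
    rw [hl, Real.le_logb_iff_rpow_le one_lt_two (by linarith), Real.rpow_one]
    linarith
  obtain ⟨s, hs⟩ : ∃ s, ⌈3 * l⌉₊ = s + 1 :=
    ⟨_, (Nat.succ_pred_eq_of_pos (Nat.ceil_pos.2 (by linarith))).symm⟩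
  have h1 : 3 * l ≤ s + 1 := by
    have := Nat.le_ceil (3 * l)
    rw [hs] at this
    exact_mod_cast this
  have h2 : (s : ℝ) ≤ 3 * l := by
    have := Nat.ceil_lt_add_one (show 0 ≤ 3 * l by linarith)
    rw [hs] at this
    push_cast at this
    linarith
  -- The slope n / (6 l) is chosen so that s ≤ 3 l gives at most n/2 ≤ m.
  have h3 : (n : ℝ) / (6 * l) * s ≤ m := by
    calc (n : ℝ) / (6 * l) * s ≤ (n : ℝ) / (6 * l) * (3 * l) := by gcongr
      _ = n / 2 := by field_simp; norm_num
      _ ≤ m := by linarith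
  rw [hs, oracleCalls]
  -- Here s ≥ 3 l - 1 ≥ 2 l, because l ≥ 1.
  calc (n : ℝ) ^ ((1 / 12 : ℝ) * l) ≤ (n : ℝ) ^ ((1 / 24 : ℝ) * s) :=
        Real.rpow_le_rpow_of_exponent_le (by linarith) (by linarith)
    _ = ((n : ℝ) ^ (1 / 24 : ℝ)) ^ s := Real.rpow_mul_natCast (by linarith) _ _
    _ ≤ (1 + (n : ℝ) / (6 * l)) ^ s := by gcongr; exact rpow_le_one_add_div_logb hn'
    _ ≤ ((m + s).choose s : ℝ) := pow_le_choose_of_mul_le (by positivity) m s h3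

/-! ### The main theorem. -/

theorem one_le_hermiteConst_of_linearIndependent {n k d : ℕ} (hkn : k ≤ n)
    {O : (Fin k → Vec d) → Vec d} (hO : IsHSVPOracle (Real.sqrt (hermiteConst k)) O)
    {B : Fin n → Vec d} (hB : LinearIndependent ℝ B) : 1 ≤ hermiteConst k := by
  refine one_le_hermiteConst_of_oracle hO (hkn.trans ?_)
  simpa using hB.fintype_card_le_finrank

theorem mainTheorem3 :
    -- correctness, Hermite factor and number of oracle calls
    (∀ (d n k τ : ℕ), 2 ≤ k → k ≤ n →
      ∀ O : (Fin k → Vec d) → Vec d, IsHSVPOracle (Real.sqrt (hermiteConst k)) O →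
      ∀ B : Fin n → Vec d, LinearIndependent ℝ B →
        (∃ (y : Vec d) (c t : ℕ), Run O (latticeOf B) τ y c t) ∧
        ∀ (y : Vec d) (c t : ℕ), Run O (latticeOf B) τ y c t →
          IsHSVPSolution
            (hermiteConst k ^ (((n : ℝ) - 1) / (2 * ((k : ℝ) - 1))) *
              (2 : ℝ) ^ ((n : ℝ) ^ 3 / (2 : ℝ) ^ τ)) B y ∧
          (τ = 0 → c = 0) ∧
          (1 ≤ τ → c = (n - k + τ - 1).choose (τ - 1)) ∧
          (3 * Real.logb 2 n ≤ τ →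
            IsHSVPSolution
              (2 * hermiteConst k ^ (((n : ℝ) - 1) / (2 * ((k : ℝ) - 1)))) B y)) ∧
    -- quasipolynomial complexity for `τ = ⌈3 log₂ n⌉`
    (∃ C c₀ : ℝ, 0 < C ∧ 0 < c₀ ∧
      ∀ (d n k τ : ℕ), 2 ≤ k → k ≤ n → τ = ⌈3 * Real.logb 2 n⌉₊ →
      ∀ O : (Fin k → Vec d) → Vec d, IsHSVPOracle (Real.sqrt (hermiteConst k)) O →
      ∀ B : Fin n → Vec d, LinearIndependent ℝ B →
      ∀ (y : Vec d) (c t : ℕ), Run O (latticeOf B) τ y c t →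
        (c : ℝ) ≤ (n : ℝ) ^ (C * Real.logb 2 n) ∧
        (t : ℝ) ≤ (n : ℝ) ^ (C * Real.logb 2 n) ∧
        (2 * k ≤ n → (n : ℝ) ^ (c₀ * Real.logb 2 n) ≤ (c : ℝ))) := by
  -- The 6 comes from 3 ≤ n² and 2 + τ ≤ 3 log₂ n + 3 ≤ 6 log₂ n.
  refine ⟨?_, 6, 1 / 12, by norm_num, by norm_num, ?_⟩
  · intro d n k τ hk hkn O hO B hB
    have hδ := one_le_hermiteConst_of_linearIndependent hkn hO hB
    have hδ0 : 0 ≤ hermiteConst k := by linarith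
    obtain ⟨m, rfl⟩ := Nat.exists_eq_add_of_le hkn
    obtain ⟨hex, hrun⟩ := run_spec hk hO hδ τ m (B := B) ⟨hB, rfl⟩
    refine ⟨hex, fun y c t h => ?_⟩
    obtain ⟨hsol, rfl, -⟩ := hrun y c t h
    have hsol' : IsHSVPSolution (hermiteConst k ^ ((((k + m : ℕ) : ℝ) - 1) / (2 * ((k : ℝ) - 1))) *
        (2 : ℝ) ^ (((k + m : ℕ) : ℝ) ^ 3 / (2 : ℝ) ^ τ)) B y :=
      hsol.mono (mul_le_mul_of_nonneg_left (Real.rpow_le_rpow_of_exponent_le one_le_two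
        (slackExponent_le (hk.trans hkn) τ)) (Real.rpow_nonneg hδ0 _))
    refine ⟨hsol', ?_, fun hτ => ?_, fun hτ => hsol'.mono ?_⟩
    · rintro rfl
      rfl
    · obtain ⟨τ, rfl⟩ := Nat.exists_eq_add_of_le' hτ
      rw [oracleCalls, Nat.add_sub_cancel_left, Nat.add_sub_cancel, ← Nat.add_assoc,
        Nat.add_sub_cancel]
    · rw [mul_comm]
      refine mul_le_mul_of_nonneg_right ?_ (Real.rpow_nonneg hδ0 _)
      have hn : (0 : ℝ) < (k + m : ℕ) := by exact_mod_cast (by omega : 0 < k + m)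
      have hpow : ((k + m : ℕ) : ℝ) ^ 3 ≤ (2 : ℝ) ^ τ := by
        rw [← Real.rpow_natCast 2 τ, ← Real.logb_le_iff_le_rpow one_lt_two (by positivity),
          Real.logb_pow]
        exact_mod_cast hτ
      calc (2 : ℝ) ^ (((k + m : ℕ) : ℝ) ^ 3 / (2 : ℝ) ^ τ) ≤ (2 : ℝ) ^ (1 : ℝ) :=
            Real.rpow_le_rpow_of_exponent_le one_le_two ((div_le_one (by positivity)).2 hpow)
        _ = 2 := Real.rpow_one 2
  · rintro d n k τ hk hkn rfl O hO B hB y c t hrun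
    have hδ := one_le_hermiteConst_of_linearIndependent hkn hO hB
    obtain ⟨m, rfl⟩ := Nat.exists_eq_add_of_le hkn
    obtain ⟨-, rfl, ht⟩ := (run_spec hk hO hδ _ m (B := B) ⟨hB, rfl⟩).2 y c t hrun
    have hup := three_mul_choose_le_rpow (n := k + m) (m := m) (by omega) (by omega)
    set τ := ⌈3 * Real.logb 2 ((k + m : ℕ) : ℝ)⌉₊
    have hc : (oracleCalls m τ : ℝ) ≤ ((m + τ).choose τ : ℝ) := by
      exact_mod_cast oracleCalls_le_choose m τ
    have ht' : (t : ℝ) + 2 = 3 * ((m + τ).choose τ : ℝ) := by exact_mod_cast ht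
    have h0 : (0 : ℝ) ≤ ((m + τ).choose τ : ℝ) := Nat.cast_nonneg _
    exact ⟨by linarith, by linarith, fun h => rpow_le_oracleCalls (by omega) (by omega)⟩
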